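/- Let $d\in\mathbb N$ and $[d]=\{1,\dots,d\}$. A ranking of $[d]$ is a function $r:[d]\to[d]$ with $\#\{b\in[d]:r(b)<r(a)\}=r(a)-1$ for every $a\in[d]$; it is called strict if it is a bijection. Let $\mathcal R$ be the finite set of rankings of $[d]$. For $x\in\mathbb R^d$ let $rk(x)\in\mathcal R$ be the unique ranking $r$ such that $r(i)<r(j)$ if and only if $x_i>x_j$, for all $i,j\in[d]$; that is, $rk(x)(i)=1+\#\{j\in[d]:x_j>x_i\}$. For each $r\in\mathcal R$ let $\mu^r$ be a Borel probability measure on $\mathbb R^d$ with finite second moments, and let $q^r_i=\int x_i\,d\mu^r(x)$, $i\in[d]$, be its means. For a probability measure $\nu$ on $\mathbb R^d$ let $\mathbb P_\nu$ denote the law of the time-homogeneous Markov chain $(X_n)_{n\ge 0}$ on $\mathbb R^d$ with initial distribution $\nu$ and transition kernel $$\mu(x,B)=\mu^{rk(x)}(\{y\in\mathbb R^d:\ y+x\in B\}),\qquad x\in\mathbb R^d,\ B\subseteq\mathbb R^d \text{ Borel}.$$ A ranking $r$ is called terminal if there is a probability measure $\nu$ on $\mathbb R^d$ with finite second moments such that,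 with positive $\mathbb P_\nu$-probability, $rk(X_n)=r$ for all sufficiently large $n$. Suppose that $\mu^r(\{x\in\mathbb R^d: x_i\neq x_j\})>0$ for all $r\in\mathcal R$ and all $i,j\in[d]$ with $i\neq j$. Then a ranking $r\in\mathcal R$ is terminal if and only if it is strict and $$q^r_{r^{-1}(1)}>q^r_{r^{-1}(2)}>\dots>q^r_{r^{-1}(d)},$$ where $r^{-1}$ denotes the inverse of $r$. -/

import Mathlib

open MeasureTheory ProbabilityTheory Filter

namespace RankingBased

/-- A ranking of `[d]`. Positions are counted from `0`: the position `k : Fin d` here is the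
position `k + 1` of the usual one-based convention. Ties are allowed; the position of `a` is the
number of elements that are ranked strictly higher than `a`. -/
@[ext]
structure Ranking (d : ℕ) where
  pos : Fin d → Fin d
  card_lt : ∀ a, (Finset.univ.filter fun b => pos b < pos a).card = (pos a : ℕ)

/-- A ranking is strict if it is a bijection onto the set of positions. -/
def Ranking.IsStrict {d : ℕ} (r : Ranking d) : Prop := Function.Bijective r.pos

/-- The inverse `r⁻¹` of a strict ranking: `h.inv k` is the element at position `k`. -/
noncomputable def Ranking.IsStrict.inv {d : ℕ} {r : Ranking d} (h : r.IsStrict) : Fin d → Fin d :=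
  (Equiv.ofBijective r.pos h).symm

instance (d : ℕ) : Finite (Ranking d) :=
  Finite.of_injective Ranking.pos fun _ _ h => Ranking.ext h

/-- The set of rankings is discrete. -/
instance (d : ℕ) : MeasurableSpace (Ranking d) := ⊤

instance (d : ℕ) : DiscreteMeasurableSpace (Ranking d) := ⟨fun _ => trivial⟩

/-- The number of components of `x` that are strictly larger than the `i`-th one. -/
noncomputable def numAbove {d : ℕ} (x : Fin d → ℝ) (i : Fin d) : ℕ :=
  (Finset.univ.filter fun j => x i < x j).card

theorem numAbove_lt {d : ℕ} (x : Fin d → ℝ) (i : Fin d) : numAbove x i < d := by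
  have h : (Finset.univ.filter fun j => x i < x j) ⊂ Finset.univ := by
    rw [Finset.ssubset_univ_iff]
    intro h
    have := Finset.mem_univ i
    rw [← h] at this
    simp at this
  simpa [numAbove] using Finset.card_lt_card h

theorem numAbove_lt_iff {d : ℕ} (x : Fin d → ℝ) (i j : Fin d) :
    numAbove x i < numAbove x j ↔ x j < x i := by
  constructor
  · intro h
    by_contra! hle
    refine absurd h (not_lt.mpr (Finset.card_le_card ?_))
    intro k hk
    simp only [Finset.mem_filter, Finset.mem_univ, true_and] at hk ⊢
    exact hle.trans_lt hk
  · intro h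
    refine Finset.card_lt_card ⟨fun k hk => ?_, fun hs => ?_⟩
    · simp only [Finset.mem_filter, Finset.mem_univ, true_and] at hk ⊢
      exact h.trans hk
    · have := @hs i (by simpa using h)
      simp at this

/-- The ranking `rk x` of the components of a vector, larger components first
(standard competition ranking). -/
noncomputable def rk {d : ℕ} (x : Fin d → ℝ) : Ranking d where
  pos i := ⟨numAbove x i, numAbove_lt x i⟩
  card_lt a := by
    simp only [Fin.mk_lt_mk, numAbove_lt_iff]
    rfl

/-- `rk x` ranks `i` higher than `j` exactly when `x i > x j`. -/
theorem rk_lt_iff {d : ℕ} (x : Fin d → ℝ) (i j : Fin d) :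
    (rk x).pos i < (rk x).pos j ↔ x i > x j :=
  numAbove_lt_iff x i j

/-- `rk x` is the only ranking with that property. -/
theorem rk_unique {d : ℕ} (x : Fin d → ℝ) (r : Ranking d)
    (hr : ∀ i j, r.pos i < r.pos j ↔ x i > x j) : r = rk x := by
  ext i
  rw [← r.card_lt i]
  simp only [hr]
  rfl

theorem measurable_rk (d : ℕ) : Measurable (rk (d := d)) := by
  refine measurable_to_countable' fun r => ?_
  have h : rk (d := d) ⁻¹' {r} = ⋂ i, ⋂ j, {x | r.pos i < r.pos j ↔ x j < x i} := by
    ext x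
    simp only [Set.mem_preimage, Set.mem_singleton_iff, Set.mem_iInter, Set.mem_ofPred_eq]
    exact ⟨fun h i j => h ▸ rk_lt_iff x i j, fun h => (rk_unique x r h).symm⟩
  rw [h]
  refine MeasurableSet.iInter fun i => MeasurableSet.iInter fun j => ?_
  have hm : MeasurableSet {x : Fin d → ℝ | x j < x i} :=
    measurableSet_lt (measurable_pi_apply j) (measurable_pi_apply i)
  by_cases hp : r.pos i < r.pos j
  · simpa [hp] using hm
  · have hm' : MeasurableSet {x : Fin d → ℝ | x i ≤ x j} :=
      measurableSet_le (measurable_pi_apply i) (measurable_pi_apply j)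
    simpa [hp] using hm'

/-- The transition kernel `μ(x, B) = μ^{rk x}(B - x)`: from the state `x`, the increment has the
law `μ (rk x)`. -/
noncomputable def transitionKernel {d : ℕ} (μ : Ranking d → Measure (Fin d → ℝ))
    [∀ r, IsProbabilityMeasure (μ r)] : Kernel (Fin d → ℝ) (Fin d → ℝ) where
  toFun x := (μ (rk x)).map fun y => y + x
  measurable' := by
    refine Measure.measurable_of_measurable_coe _ fun B hB => ?_
    have h1 : ∀ r, Measurable fun x : Fin d → ℝ => μ r {y | y + x ∈ B} := fun r =>
      measurable_measure_prodMk_left (ν := μ r) (s := {p | p.2 + p.1 ∈ B})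
        ((measurable_snd.add measurable_fst) hB)
    have h2 : Measurable fun p : Ranking d × (Fin d → ℝ) => μ p.1 {y | y + p.2 ∈ B} :=
      measurable_from_prod_countable_right h1
    have h3 := h2.comp ((measurable_rk d).prodMk measurable_id)
    have h4 : (fun x : Fin d → ℝ => ((μ (rk x)).map fun y => y + x) B) =
        fun x => μ (rk x) {y | y + x ∈ B} := by
      funext x
      exact Measure.map_apply (by fun_prop) hB
    rw [h4]
    exact h3

instance {d : ℕ} (μ : Ranking d → Measure (Fin d → ℝ)) [∀ r, IsProbabilityMeasure (μ r)] :
    IsMarkovKernel (transitionKernel μ) :=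
  ⟨fun x => Measure.isProbabilityMeasure_map (μ := μ (rk x)) (by fun_prop)⟩

/-- The same in the form of the usual formula. -/
theorem transitionKernel_apply {d : ℕ} (μ : Ranking d → Measure (Fin d → ℝ))
    [∀ r, IsProbabilityMeasure (μ r)] (x : Fin d → ℝ) {B : Set (Fin d → ℝ)}
    (hB : MeasurableSet B) : transitionKernel μ x B = μ (rk x) {y | y + x ∈ B} :=
  Measure.map_apply (μ := μ (rk x)) (by fun_prop) hB

/-- The law `ℙ_ν`, on the space of trajectories `ω = (X₀, X₁, …)`, of the time-homogeneous Markov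
chain with initial distribution `ν` and transition kernel `transitionKernel μ`: the
`d`-dimensional ranking-based process with increment laws `μ` started from `ν`. -/
noncomputable def processLaw {d : ℕ} (ν : Measure (Fin d → ℝ))
    (μ : Ranking d → Measure (Fin d → ℝ)) [∀ r, IsProbabilityMeasure (μ r)] :
    Measure (ℕ → Fin d → ℝ) :=
  Kernel.trajMeasure (X := fun _ => Fin d → ℝ) ν fun n =>
    (transitionKernel μ).comap (fun past => past ⟨n, Finset.mem_Iic.mpr le_rfl⟩)
      (measurable_pi_apply _)

/-- All components of the distribution `ρ` have a finite second moment. -/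
def FiniteSecondMoments {d : ℕ} (ρ : Measure (Fin d → ℝ)) : Prop :=
  ∀ i, MemLp (fun x : Fin d → ℝ => x i) 2 ρ

/-- The mean of the `i`-th component of the distribution `ρ`. -/
noncomputable def mean {d : ℕ} (ρ : Measure (Fin d → ℝ)) (i : Fin d) : ℝ := ∫ x, x i ∂ρ

/-- The event `rk(Xₙ) → r`: the ranking equals `r` from some time on. -/
def rankingConverges {d : ℕ} (r : Ranking d) : Set (ℕ → Fin d → ℝ) :=
  {ω | ∃ n₀, ∀ n ≥ n₀, rk (ω n) = r}

/-- A ranking is terminal (for the transition kernel given by `μ`) if `ℙ_ν(rk(Xₙ) → r) > 0` for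
some initial distribution `ν` (with finite second moments). -/
def IsTerminal {d : ℕ} (μ : Ranking d → Measure (Fin d → ℝ)) [∀ r, IsProbabilityMeasure (μ r)]
    (r : Ranking d) : Prop :=
  ∃ ν : Measure (Fin d → ℝ), IsProbabilityMeasure ν ∧ FiniteSecondMoments ν ∧
    0 < processLaw ν μ (rankingConverges r)

end RankingBased

/-! While the ranking stays equal to `r`, the chain is a random walk with increment law `μ r`. So
from time `k` on it keeps `r` forever with the probability that such a walk, started from the
position at time `k`, does so (`processLaw_forall_rk_eq`), and the claim reduces to walks.

If a walk keeps `r` with positive probability and `i` is ranked at least as high as `j`, then the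
difference of components `i` and `j` never becomes negative on that event. This difference is a
non-degenerate real random walk with finite variance, so with drift `≤ 0` it would almost surely
fall below every level, by the strong law for negative drift and by the central limit theorem with
Kolmogorov's zero-one law for zero drift. Hence the drift is positive. A tie would make it positive
in both directions, so `r` is strict.

Conversely, if the means are ordered, all relevant differences drift to infinity and are bounded
below almost surely. Started with large enough gaps in the order `r`, the walk keeps `r` with
positive probability. -/

namespace RankingBased

/-! ### Real random walks: drift and oscillation. -/

section RandomWalk

variable {Ω : Type*} {mΩ : MeasurableSpace Ω} {P : Measure Ω} {X : ℕ → Ω → ℝ}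

/-- A random walk with positive drift tends to infinity. -/
theorem ae_tendsto_sum_atTop (hint : Integrable (X 0) P)
    (hindep : iIndepFun X P) (hident : ∀ i, IdentDistrib (X i) (X 0) P P) (h0 : 0 < P[X 0]) :
    ∀ᵐ ω ∂P, Tendsto (fun n => ∑ i ∈ Finset.range n, X i ω) atTop atTop := by
  filter_upwards [strong_law_ae_real X hint (fun i j hij => hindep.indepFun hij) hident] with ω hω
  refine (hω.pos_mul_atTop h0 tendsto_natCast_atTop_atTop).congr' ?_
  filter_upwards [eventually_gt_atTop 0] with n hn
  field_simp

/-- A random walk with negative drift tends to minus infinity. -/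
theorem ae_tendsto_sum_atBot (hint : Integrable (X 0) P)
    (hindep : iIndepFun X P) (hident : ∀ i, IdentDistrib (X i) (X 0) P P) (h0 : P[X 0] < 0) :
    ∀ᵐ ω ∂P, Tendsto (fun n => ∑ i ∈ Finset.range n, X i ω) atTop atBot := by
  filter_upwards [strong_law_ae_real X hint (fun i j hij => hindep.indepFun hij) hident] with ω hω
  refine (hω.neg_mul_atTop h0 tendsto_natCast_atTop_atTop).congr' ?_
  filter_upwards [eventually_gt_atTop 0] with n hn
  field_simp

/-- Reverse Fatou inequality for sets, in the form of a uniform lower bound. -/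
theorem le_measure_frequently [IsFiniteMeasure P] {A : ℕ → Set Ω}
    (hA : ∀ n, MeasurableSet (A n)) {δ : ENNReal} (h : ∃ᶠ n in atTop, δ ≤ P (A n)) :
    δ ≤ P {ω | ∃ᶠ n in atTop, ω ∈ A n} := by
  have hE : {ω | ∃ᶠ n in atTop, ω ∈ A n} = ⋂ N, ⋃ n, ⋃ _ : N ≤ n, A n := by
    ext ω
    simp [frequently_atTop]
  rw [hE]
  have ht := tendsto_measure_iInter_atTop (μ := P) (s := fun N => ⋃ n, ⋃ _ : N ≤ n, A n)
    (fun N => (MeasurableSet.iUnion fun n => MeasurableSet.iUnion fun _ => hA n).nullMeasurableSet)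
    (fun M N hMN => Set.iUnion_mono fun n => Set.iUnion_mono' fun hn => ⟨hMN.trans hn, le_rfl⟩)
    ⟨0, measure_ne_top _ _⟩
  refine ge_of_tendsto' ht fun N => ?_
  obtain ⟨n, hn, hδ⟩ := frequently_atTop.mp h N
  exact hδ.trans (measure_mono fun ω hω => Set.mem_iUnion₂.mpr ⟨n, hn, hω⟩)

/-- The first `N` terms change the sums by a constant, which the quantifier over all levels absorbs.
This is what makes the event below a tail event. -/
theorem frequently_sum_lt_shift_iff (x : ℕ → ℝ) (N : ℕ) :
    (∀ M : ℕ, ∃ᶠ n in atTop, ∑ i ∈ Finset.range n, x i < -(M : ℝ)) ↔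
      ∀ M : ℕ, ∃ᶠ n in atTop, ∑ i ∈ Finset.Ico N n, x i < -(M : ℝ) := by
  have hs : ∀ n ≥ N, ∑ i ∈ Finset.range n, x i =
      ∑ i ∈ Finset.range N, x i + ∑ i ∈ Finset.Ico N n, x i := fun n hn =>
    (Finset.sum_range_add_sum_Ico _ hn).symm
  constructor
  · intro h M
    obtain ⟨K, hK⟩ := exists_nat_ge (M - ∑ i ∈ Finset.range N, x i)
    refine ((h K).and_eventually (eventually_ge_atTop N)).mono fun n hn => ?_
    have := hs n hn.2
    linarith [hn.1]
  · intro h M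
    obtain ⟨K, hK⟩ := exists_nat_ge (M + ∑ i ∈ Finset.range N, x i)
    refine ((h K).and_eventually (eventually_ge_atTop N)).mono fun n hn => ?_
    have := hs n hn.2
    linarith [hn.1]

/-- The event that the lower limit of the partial sums is `-∞` is a tail event. -/
theorem measurableSet_tail_frequently_sum_lt :
    MeasurableSet[limsup (fun i => MeasurableSpace.comap (X i) inferInstance) atTop]
      {ω | ∀ M : ℕ, ∃ᶠ n in atTop, ∑ i ∈ Finset.range n, X i ω < -(M : ℝ)} := by
  rw [limsup_eq_iInf_iSup_of_nat, MeasurableSpace.measurableSet_iInf]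
  intro N
  simp_rw [fun ω => frequently_sum_lt_shift_iff (fun i => X i ω) N]
  set m := ⨆ i, ⨆ (_ : i ≥ N), MeasurableSpace.comap (X i) inferInstance with hm
  have hX : ∀ i ≥ N, Measurable[m] (X i) := fun i hi =>
    (comap_measurable (X i)).mono (le_iSup₂_of_le i hi le_rfl) le_rfl
  have hS : ∀ n, Measurable[m] fun ω => ∑ i ∈ Finset.Ico N n, X i ω := fun n =>
    Finset.measurable_sum _ fun i hi => hX i (Finset.mem_Ico.mp hi).1
  have hE : {ω | ∀ M : ℕ, ∃ᶠ n in atTop, ∑ i ∈ Finset.Ico N n, X i ω < -(M : ℝ)} =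
      ⋂ M : ℕ, ⋂ K : ℕ, ⋃ n, ⋃ _ : K ≤ n, {ω | ∑ i ∈ Finset.Ico N n, X i ω < -(M : ℝ)} := by
    ext ω
    simp [frequently_atTop]
  rw [hE]
  exact MeasurableSet.iInter fun M => MeasurableSet.iInter fun K => MeasurableSet.iUnion fun n =>
    MeasurableSet.iUnion fun _ => hS n measurableSet_Iio

/-- The lower limit of a non-degenerate centered random walk with finite variance is `-∞`. -/
theorem ae_frequently_sum_lt_of_mean_zero [IsProbabilityMeasure P] (hmeas : ∀ i, Measurable (X i))
    (hL2 : MemLp (X 0) 2 P) (hindep : iIndepFun X P)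
    (hident : ∀ i, IdentDistrib (X i) (X 0) P P) (h0 : P[X 0] = 0) (hne : ¬ X 0 =ᵐ[P] 0) :
    ∀ᵐ ω ∂P, ∀ M : ℕ, ∃ᶠ n in atTop, ∑ i ∈ Finset.range n, X i ω < -(M : ℝ) := by
  have hvar : Var[X 0; P] ≠ 0 := fun hv => hne <| by
    filter_upwards [ae_eq_integral_of_variance_eq_zero hL2 hv] with ω hω
    simpa [h0] using hω
  have hv : Var[X 0; P].toNNReal ≠ 0 := by
    simpa using (variance_nonneg (X 0) P).lt_of_ne' hvar
  set γ := gaussianReal 0 Var[X 0; P].toNNReal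
  have hclt := tendstoInDistribution_inv_sqrt_mul_sum_sub (P := P) (P' := γ) (X := X) (Y := id)
    HasLaw.id hL2 hindep hident
  -- Portmanteau: normalized sums below `-1` keep, in the limit, at least the positive mass that the
  -- limiting Gaussian gives to this open half-line.
  have hlim := ProbabilityMeasure.le_liminf_measure_open_of_tendsto hclt.tendsto
    (isOpen_Iio (a := (-1 : ℝ)))
  simp only [ProbabilityMeasure.coe_mk, Measure.map_id, h0, mul_zero, sub_zero] at hlim
  have hγ : 0 < γ (Set.Iio (-1)) := by
    have : γ.IsOpenPosMeasure := (gaussianReal_absolutelyContinuous' 0 hv).isOpenPosMeasure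
    exact isOpen_Iio.measure_pos _ ⟨-2, by norm_num⟩
  obtain ⟨δ, hδ0, hδ⟩ := exists_between hγ
  set A : ℕ → Set Ω := fun n => {ω | (√(n : ℝ))⁻¹ * ∑ i ∈ Finset.range n, X i ω < -1}
  have hSm : ∀ n : ℕ, Measurable fun ω => (√(n : ℝ))⁻¹ * ∑ i ∈ Finset.range n, X i ω :=
    fun n => by fun_prop
  have hev : ∀ᶠ n in atTop, δ < P (A n) := by
    filter_upwards [eventually_lt_of_lt_liminf (hδ.trans_le hlim)] with n hn
    rwa [Measure.map_apply (hSm n) measurableSet_Iio] at hn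
  have hle := le_measure_frequently (P := P) (fun n => hSm n measurableSet_Iio)
    (hev.frequently.mono fun _ h => h.le)
  have hsub : {ω | ∃ᶠ n in atTop, ω ∈ A n} ⊆
      {ω | ∀ M : ℕ, ∃ᶠ n in atTop, ∑ i ∈ Finset.range n, X i ω < -(M : ℝ)} := by
    intro ω hω M
    -- On `A n` the sum is below `-√n`, hence below `-M` once `n > M ^ 2`.
    refine (Frequently.and_eventually hω (eventually_gt_atTop (M ^ 2))).mono fun n hn => ?_
    have hn1 : (√(n : ℝ))⁻¹ * ∑ i ∈ Finset.range n, X i ω < -1 := hn.1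
    have hM : (M : ℝ) < √n := Real.lt_sqrt_of_sq_lt (by exact_mod_cast hn.2)
    have hpos : 0 < √(n : ℝ) := (Nat.cast_nonneg M).trans_lt hM
    rw [inv_mul_lt_iff₀ hpos] at hn1
    linarith
  have hpos := hδ0.trans_le (hle.trans (measure_mono hsub))
  -- Kolmogorov's zero-one law upgrades positive probability to probability one.
  have h01 := measure_zero_or_one_of_measurableSet_limsup_atTop
    (fun i => (hmeas i).comap_le) hindep (measurableSet_tail_frequently_sum_lt (X := X))
  have h1 := h01.resolve_left hpos.ne'
  have hms : MeasurableSet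
      {ω | ∀ M : ℕ, ∃ᶠ n in atTop, ∑ i ∈ Finset.range n, X i ω < -(M : ℝ)} :=
    (limsup_le_iSup.trans (iSup_le fun i => (hmeas i).comap_le)) _
      measurableSet_tail_frequently_sum_lt
  exact (prob_compl_eq_zero_iff hms).mpr h1

/-- A non-degenerate random walk with finite variance and non-positive drift falls below every
level. -/
theorem ae_exists_sum_lt_of_mean_nonpos [IsProbabilityMeasure P] (hmeas : ∀ i, Measurable (X i))
    (hL2 : MemLp (X 0) 2 P) (hindep : iIndepFun X P)
    (hident : ∀ i, IdentDistrib (X i) (X 0) P P) (h0 : P[X 0] ≤ 0) (hne : ¬ X 0 =ᵐ[P] 0) (c : ℝ) :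
    ∀ᵐ ω ∂P, ∃ n, ∑ i ∈ Finset.range n, X i ω < c := by
  rcases h0.lt_or_eq with h | h
  · filter_upwards [ae_tendsto_sum_atBot (hL2.integrable one_le_two) hindep hident h] with ω hω
    exact (hω.eventually_lt_atBot c).exists
  · filter_upwards [ae_frequently_sum_lt_of_mean_zero hmeas hL2 hindep hident h hne] with ω hω
    obtain ⟨M, hM⟩ := exists_nat_ge (-c)
    obtain ⟨n, hn⟩ := (hω M).exists
    exact ⟨n, by linarith⟩

end RandomWalk

/-! ### Comparing a process with a random walk while it stays in a set. -/

section Comparison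

theorem measurableSet_forall_lt {Ω E : Type*} [MeasurableSpace Ω] [MeasurableSpace E]
    {Y : ℕ → Ω → E} (hY : ∀ m, Measurable (Y m)) {C : Set E} (hC : MeasurableSet C) (n : ℕ) :
    MeasurableSet {ω | ∀ m < n, Y m ω ∈ C} := by
  simp only [Set.ofPred_forall]
  exact MeasurableSet.iInter fun m => MeasurableSet.iInter fun _ => hY m hC

theorem tendsto_measure_forall_lt {Ω E : Type*} [MeasurableSpace Ω] [MeasurableSpace E]
    {P : Measure Ω} [IsFiniteMeasure P] {Y : ℕ → Ω → E} (hY : ∀ m, Measurable (Y m)) {C : Set E}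
    (hC : MeasurableSet C) :
    Tendsto (fun n => P {ω | ∀ m < n, Y m ω ∈ C}) atTop (nhds (P {ω | ∀ m, Y m ω ∈ C})) := by
  have hE : {ω | ∀ m, Y m ω ∈ C} = ⋂ n, {ω | ∀ m < n, Y m ω ∈ C} := by
    ext ω
    simp only [Set.mem_iInter, Set.mem_ofPred_eq]
    exact ⟨fun h n m _ => h m, fun h m => h (m + 1) m m.lt_succ_self⟩
  rw [hE]
  exact tendsto_measure_iInter_atTop
    (fun n => (measurableSet_forall_lt hY hC n).nullMeasurableSet)
    (fun a b hab ω hω m hm => hω m (hm.trans_le hab)) ⟨0, measure_ne_top _ _⟩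

/-- The transition operator of a random walk with increment law `ρ`, killed outside `C`. -/
noncomputable def killedStep {E : Type*} [Add E] [MeasurableSpace E] (ρ : Measure E) (C : Set E)
    (f : E → ENNReal) : E → ENNReal :=
  C.indicator fun x => ∫⁻ y, f (y + x) ∂ρ

/-- The random walk started from `x` with increments `ξ`. -/
def walk {E : Type*} [AddCommMonoid E] (x : E) (n : ℕ) (ξ : ℕ → E) : E :=
  x + ∑ i ∈ Finset.range n, ξ i

variable {E : Type*} [AddCommMonoid E] [MeasurableSpace E] [MeasurableAdd₂ E]

@[fun_prop]
theorem measurable_walk (x : E) (n : ℕ) : Measurable (walk x n) := by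
  unfold walk
  fun_prop

theorem measurable_killedStep (ρ : Measure E) [SFinite ρ] {C : Set E} (hC : MeasurableSet C)
    {f : E → ENNReal} (hf : Measurable f) : Measurable (killedStep ρ C f) :=
  (Measurable.lintegral_prod_right' (f := fun p : E × E => f (p.2 + p.1))
    (hf.comp (measurable_snd.add measurable_fst))).indicator hC

theorem measurable_iterate_killedStep (ρ : Measure E) [SFinite ρ] {C : Set E}
    (hC : MeasurableSet C) {f : E → ENNReal} (hf : Measurable f) (n : ℕ) :
    Measurable ((killedStep ρ C)^[n] f) := by
  induction n generalizing f with
  | zero => exact hf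
  | succ n ih => exact ih (measurable_killedStep ρ hC hf)

/-- If, as long as it stays in `C`, a process moves like a random walk with increment law `ρ`,
then its law while it stays in `C` is given by the iterates of the killed transition operator. -/
theorem setLIntegral_eq_lintegral_iterate_killedStep {Ω : Type*} [MeasurableSpace Ω]
    {P : Measure Ω} {Y : ℕ → Ω → E} (hY : ∀ m, Measurable (Y m)) {ρ : Measure E} [SFinite ρ]
    {C : Set E} (hC : MeasurableSet C)
    (hstep : ∀ n (f : E → ENNReal), Measurable f →
      ∫⁻ ω in {ω | ∀ m < n + 1, Y m ω ∈ C}, f (Y (n + 1) ω) ∂P =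
        ∫⁻ ω in {ω | ∀ m < n + 1, Y m ω ∈ C}, ∫⁻ y, f (y + Y n ω) ∂ρ ∂P)
    (n : ℕ) {f : E → ENNReal} (hf : Measurable f) :
    ∫⁻ ω in {ω | ∀ m < n, Y m ω ∈ C}, f (Y n ω) ∂P =
      ∫⁻ ω, (killedStep ρ C)^[n] f (Y 0 ω) ∂P := by
  induction n generalizing f with
  | zero => simp
  | succ n ih =>
    rw [hstep n f hf, Function.iterate_succ_apply, ← ih (measurable_killedStep ρ hC hf)]
    have hset : {ω | ∀ m < n + 1, Y m ω ∈ C} = Y n ⁻¹' C ∩ {ω | ∀ m < n, Y m ω ∈ C} := by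
      ext ω
      simp only [Set.mem_ofPred_eq, Set.mem_inter_iff, Set.mem_preimage, Nat.forall_lt_succ_right]
      exact and_comm
    rw [hset, ← Measure.restrict_restrict (hY n hC), ← lintegral_indicator (hY n hC)]
    rfl

/-- The one-step property of the random walk. -/
theorem setLIntegral_walk_succ (ρ : Measure E) [IsProbabilityMeasure ρ] (x : E) {C : Set E}
    (hC : MeasurableSet C) (n : ℕ) {f : E → ENNReal} (hf : Measurable f) :
    ∫⁻ ξ in {ξ | ∀ m < n + 1, walk x m ξ ∈ C}, f (walk x (n + 1) ξ)
        ∂(Measure.infinitePi fun _ : ℕ => ρ) =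
      ∫⁻ ξ in {ξ | ∀ m < n + 1, walk x m ξ ∈ C}, ∫⁻ y, f (y + walk x n ξ) ∂ρ
        ∂(Measure.infinitePi fun _ : ℕ => ρ) := by
  set Q := Measure.infinitePi fun _ : ℕ => ρ
  have hA := measurableSet_forall_lt (measurable_walk x) hC (n + 1)
  let F : (ℕ → E) → (Finset.range n → E) := fun ξ i => ξ i
  -- Padding the first `n` increments with zeros leaves the walk up to time `n` unchanged, so
  -- everything except the increment `ξ n` is a function of `F ξ`, which is independent of `ξ n`.
  let ψ : (Finset.range n → E) → ℕ → E := fun p i => if h : i ∈ Finset.range n then p ⟨i, h⟩ else 0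
  have hF : Measurable F := by fun_prop
  have hψ : Measurable ψ := by
    refine measurable_pi_lambda _ fun i => ?_
    by_cases h : i ∈ Finset.range n
    · simpa only [ψ, h, dite_true] using measurable_pi_apply _
    · simpa only [ψ, h, dite_false] using measurable_const
  have hw : ∀ m ≤ n, ∀ ξ, walk x m (ψ (F ξ)) = walk x m ξ := fun m hm ξ => by
    refine congrArg (x + ·) (Finset.sum_congr rfl fun i hi => dif_pos ?_)
    exact Finset.mem_range.mpr ((Finset.mem_range.mp hi).trans_le hm)
  have hmem : ∀ ξ, ψ (F ξ) ∈ {ξ | ∀ m < n + 1, walk x m ξ ∈ C} ↔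
      ξ ∈ {ξ | ∀ m < n + 1, walk x m ξ ∈ C} := fun ξ =>
    forall₂_congr fun m hm => by rw [hw m (Nat.lt_succ_iff.mp hm)]
  let Φ : (Finset.range n → E) × E → ENNReal := fun p =>
    {ξ | ∀ m < n + 1, walk x m ξ ∈ C}.indicator (fun ξ => f (p.2 + walk x n ξ)) (ψ p.1)
  have hΦ : Measurable Φ := by
    have h1 : Measurable fun p : (Finset.range n → E) × E => f (p.2 + walk x n (ψ p.1)) := by
      fun_prop
    exact h1.indicator ((hψ.comp measurable_fst) hA)
  have hind : IndepFun F (fun ξ => ξ n) Q := by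
    have h := (iIndepFun_infinitePi (P := fun _ : ℕ => ρ) (X := fun _ ω => ω)
      fun _ => measurable_id).indepFun_finset (Finset.range n) {n} (by simp) (by fun_prop)
    have hlast : Measurable fun p : (({n} : Finset ℕ) → E) => p ⟨n, Finset.mem_singleton_self n⟩ :=
      measurable_pi_apply _
    exact h.comp measurable_id hlast
  have hmap := hind.map_prod_eq_prod_map_map hF.aemeasurable
    (measurable_pi_apply n).aemeasurable
  rw [Measure.infinitePi_map_eval] at hmap
  have hl : ∫⁻ ξ, Φ (F ξ, ξ n) ∂Q = ∫⁻ ξ, ∫⁻ y, Φ (F ξ, y) ∂ρ ∂Q := by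
    rw [← lintegral_map (f := Φ) (g := fun ξ => (F ξ, ξ n)) hΦ (by fun_prop), hmap,
      lintegral_prod _ hΦ.aemeasurable, lintegral_map hΦ.lintegral_prod_right' hF]
  rw [← lintegral_indicator hA, ← lintegral_indicator hA]
  refine Eq.trans (lintegral_congr fun ξ => ?_) (hl.trans (lintegral_congr fun ξ => ?_))
  · by_cases h : ξ ∈ {ξ | ∀ m < n + 1, walk x m ξ ∈ C}
    · simp only [Φ, Set.indicator_of_mem h, Set.indicator_of_mem ((hmem ξ).mpr h), hw n le_rfl]
      congr 1
      simp only [walk, Finset.sum_range_succ]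
      abel
    · simp only [Φ, Set.indicator_of_notMem h, Set.indicator_of_notMem (mt (hmem ξ).mp h)]
  · by_cases h : ξ ∈ {ξ | ∀ m < n + 1, walk x m ξ ∈ C}
    · simp only [Φ, Set.indicator_of_mem h, Set.indicator_of_mem ((hmem ξ).mpr h), hw n le_rfl]
    · simp only [Φ, Set.indicator_of_notMem h, Set.indicator_of_notMem (mt (hmem ξ).mp h),
        lintegral_zero]

theorem infinitePi_walk_mem_eq (ρ : Measure E) [IsProbabilityMeasure ρ] (x : E) {C : Set E}
    (hC : MeasurableSet C) (n : ℕ) :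
    Measure.infinitePi (fun _ : ℕ => ρ) {ξ | ∀ m < n, walk x m ξ ∈ C} =
      (killedStep ρ C)^[n] 1 x := by
  have h := setLIntegral_eq_lintegral_iterate_killedStep (measurable_walk x) hC
    (fun n f hf => setLIntegral_walk_succ ρ x hC n hf) n (f := 1) measurable_const
  simpa [walk] using h

/-- A process that moves like a random walk while it is in `C` stays in `C` forever with the same
probability as the random walk started from the same position. -/
theorem measure_forall_mem_eq_lintegral_walk {Ω : Type*} [MeasurableSpace Ω]
    {P : Measure Ω} [IsProbabilityMeasure P] {Y : ℕ → Ω → E} (hY : ∀ m, Measurable (Y m))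
    {ρ : Measure E} [IsProbabilityMeasure ρ] {C : Set E} (hC : MeasurableSet C)
    (hstep : ∀ n (f : E → ENNReal), Measurable f →
      ∫⁻ ω in {ω | ∀ m < n + 1, Y m ω ∈ C}, f (Y (n + 1) ω) ∂P =
        ∫⁻ ω in {ω | ∀ m < n + 1, Y m ω ∈ C}, ∫⁻ y, f (y + Y n ω) ∂ρ ∂P) :
    P {ω | ∀ m, Y m ω ∈ C} =
      ∫⁻ ω, Measure.infinitePi (fun _ : ℕ => ρ) {ξ | ∀ m, walk (Y 0 ω) m ξ ∈ C} ∂P := by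
  -- For a finite horizon both sides are the same iterate of the killed operator applied to `1`,
  -- evaluated at the starting position; then the horizon tends to infinity.
  have hn : ∀ n, P {ω | ∀ m < n, Y m ω ∈ C} =
      ∫⁻ ω, Measure.infinitePi (fun _ : ℕ => ρ) {ξ | ∀ m < n, walk (Y 0 ω) m ξ ∈ C} ∂P := by
    intro n
    simp_rw [infinitePi_walk_mem_eq ρ _ hC]
    rw [← setLIntegral_eq_lintegral_iterate_killedStep hY hC hstep n (f := 1) measurable_const]
    simp
  refine tendsto_nhds_unique (tendsto_measure_forall_lt hY hC) ?_
  simp_rw [hn]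
  refine tendsto_lintegral_of_dominated_convergence 1 (fun n => ?_)
    (fun n => Eventually.of_forall fun ω => prob_le_one) (by simp)
    (Eventually.of_forall fun ω => tendsto_measure_forall_lt (measurable_walk _) hC)
  simp_rw [infinitePi_walk_mem_eq ρ _ hC]
  exact (measurable_iterate_killedStep ρ hC measurable_const n).comp (hY 0)

end Comparison

/-! ### The Markov property and the reduction of the chain to random walks. -/

section ChainLaw

variable {d : ℕ} (ν : Measure (Fin d → ℝ)) (μ : Ranking d → Measure (Fin d → ℝ)) [∀ r, IsProbabilityMeasure (μ r)]

instance [IsProbabilityMeasure ν] : IsProbabilityMeasure (processLaw ν μ) := by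
  unfold processLaw
  infer_instance

theorem lintegral_transitionKernel (x : Fin d → ℝ) {f : (Fin d → ℝ) → ENNReal}
    (hf : Measurable f) :
    ∫⁻ y, f y ∂(transitionKernel μ x) = ∫⁻ y, f (y + x) ∂(μ (rk x)) :=
  lintegral_map (μ := μ (rk x)) hf (measurable_add_const x)

/-- The law of the initial state under `processLaw ν μ` is `ν`. -/
theorem processLaw_map_eval_zero : (processLaw ν μ).map (fun ω => ω 0) = ν := by
  have h1 : (fun ω : ℕ → Fin d → ℝ => ω 0) =
      (fun p : (i : Finset.Iic 0) → Fin d → ℝ => p ⟨0, by simp⟩) ∘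
        Preorder.frestrictLe (π := fun _ => Fin d → ℝ) 0 := rfl
  rw [h1, ← Measure.map_map (by fun_prop) (by fun_prop), processLaw, Kernel.trajMeasure,
    Measure.map_comp _ _ (by fun_prop), Kernel.traj_map_frestrictLe, Kernel.partialTraj_self,
    Measure.id_comp, Measure.map_map (by fun_prop) (by fun_prop)]
  exact Measure.map_id

variable [IsProbabilityMeasure ν]

/-- The Markov property of `processLaw ν μ` for one step. -/
theorem setLIntegral_processLaw_succ (a : ℕ) {A : Set ((i : Finset.Iic a) → Fin d → ℝ)}
    (hA : MeasurableSet A) {f : (Fin d → ℝ) → ENNReal} (hf : Measurable f) :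
    ∫⁻ ω in Preorder.frestrictLe (π := fun _ => Fin d → ℝ) a ⁻¹' A, f (ω (a + 1))
        ∂(processLaw ν μ) =
      ∫⁻ ω in Preorder.frestrictLe (π := fun _ => Fin d → ℝ) a ⁻¹' A,
        ∫⁻ y, f (y + ω a) ∂(μ (rk (ω a))) ∂(processLaw ν μ) := by
  -- The joint law of the history up to `a` and the next state is the law of the history composed
  -- with the kernel.
  have hmap := Kernel.map_frestrictLe_trajMeasure_compProd_eq_map_trajMeasure
    (X := fun _ => Fin d → ℝ) (μ₀ := ν) (a := a)
    (κ := fun n => (transitionKernel μ).comap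
      (fun past : (i : Finset.Iic n) → Fin d → ℝ => past ⟨n, Finset.mem_Iic.mpr le_rfl⟩)
      (measurable_pi_apply _))
  change (processLaw ν μ).map _ ⊗ₘ _ = (processLaw ν μ).map _ at hmap
  have hres : Measurable (Preorder.frestrictLe (π := fun _ : ℕ => Fin d → ℝ) a) := by fun_prop
  have h1 : ∫⁻ ω in Preorder.frestrictLe (π := fun _ => Fin d → ℝ) a ⁻¹' A, f (ω (a + 1))
      ∂(processLaw ν μ) = ∫⁻ p in A ×ˢ Set.univ, f p.2 ∂((processLaw ν μ).map
        fun ω => (Preorder.frestrictLe (π := fun _ => Fin d → ℝ) a ω, ω (a + 1))) := by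
    rw [setLIntegral_map (hA.prod MeasurableSet.univ) (by fun_prop) (by fun_prop)]
    congr 2
    ext ω
    simp
  rw [h1, ← hmap, Measure.setLIntegral_compProd (f := fun p => f p.2) (hf.comp measurable_snd) hA MeasurableSet.univ]
  simp only [Measure.restrict_univ, Kernel.comap_apply]
  have hm : Measurable fun p : (i : Finset.Iic a) → Fin d → ℝ =>
      ∫⁻ y, f y ∂(transitionKernel μ (p ⟨a, Finset.mem_Iic.mpr le_rfl⟩)) :=
    (hf.lintegral_kernel (κ := transitionKernel μ)).comp (measurable_pi_apply _)
  rw [setLIntegral_map hA hm hres]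
  simp_rw [lintegral_transitionKernel μ _ hf]
  rfl

theorem measurableSet_rk_eq (r : Ranking d) : MeasurableSet {x | rk x = r} :=
  measurable_rk d (measurableSet_singleton r)

/-- The process keeps the ranking `r` from time `k` on with the same probability as the random walk
with increment law `μ r` started from its position at time `k`. -/
theorem processLaw_forall_rk_eq (r : Ranking d) (k : ℕ) :
    processLaw ν μ {ω | ∀ m, rk (ω (k + m)) = r} =
      ∫⁻ ω, Measure.infinitePi (fun _ : ℕ => μ r) {ξ | ∀ m, rk (walk (ω k) m ξ) = r}
        ∂(processLaw ν μ) := by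
  refine measure_forall_mem_eq_lintegral_walk (Y := fun m (ω : ℕ → Fin d → ℝ) => ω (k + m))
    (fun m => measurable_pi_apply _) (measurableSet_rk_eq r) fun n f hf => ?_
  -- The event of keeping `r` from time `k` to `k + n`, as a condition on the history; on it the
  -- next increment has law `μ r`.
  have hA : MeasurableSet {p : (i : Finset.Iic (k + n)) → Fin d → ℝ |
      ∀ m, ∀ h : m < n + 1, rk (p ⟨k + m, Finset.mem_Iic.mpr (by omega)⟩) = r} := by
    simp only [Set.ofPred_forall]
    exact MeasurableSet.iInter fun m => MeasurableSet.iInter fun _ =>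
      (measurableSet_rk_eq r).preimage (measurable_pi_apply _)
  refine (setLIntegral_processLaw_succ ν μ (k + n) hA hf).trans ?_
  refine setLIntegral_congr_fun (hA.preimage (by fun_prop)) fun ω hω => ?_
  have : rk (ω (k + n)) = r := hω n n.lt_succ_self
  simp only [this]

end ChainLaw

/-! ### Component differences of the walk and the order of the drifts. -/

section Increments

variable {d : ℕ} (ρ : Measure (Fin d → ℝ)) [IsProbabilityMeasure ρ] (i j : Fin d)

/-- The differences of the `i`-th and `j`-th components of the increments. -/
def incrDiff (n : ℕ) (ξ : ℕ → Fin d → ℝ) : ℝ := ξ n i - ξ n j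

theorem walk_apply_sub (x : Fin d → ℝ) (n : ℕ) (ξ : ℕ → Fin d → ℝ) :
    walk x n ξ i - walk x n ξ j = x i - x j + ∑ m ∈ Finset.range n, incrDiff i j m ξ := by
  simp only [walk, Pi.add_apply, Finset.sum_apply, incrDiff, Finset.sum_sub_distrib]
  ring

theorem measurable_incrDiff (n : ℕ) : Measurable (incrDiff i j n) := by
  unfold incrDiff
  fun_prop

theorem iIndepFun_incrDiff :
    iIndepFun (incrDiff i j) (Measure.infinitePi fun _ : ℕ => ρ) :=
  iIndepFun_infinitePi (P := fun _ : ℕ => ρ) (X := fun _ y => y i - y j) fun _ => by fun_prop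

theorem identDistrib_incrDiff (n : ℕ) :
    IdentDistrib (incrDiff i j n) (fun y => y i - y j)
      (Measure.infinitePi fun _ : ℕ => ρ) ρ where
  aemeasurable_fst := (measurable_incrDiff i j n).aemeasurable
  aemeasurable_snd := by fun_prop
  map_eq := by
    have h := Measure.map_map (μ := Measure.infinitePi fun _ : ℕ => ρ)
      (g := fun y : Fin d → ℝ => y i - y j) (f := fun ξ => ξ n) (by fun_prop) (by fun_prop)
    rw [Measure.infinitePi_map_eval] at h
    exact h.symm

variable {ρ}

theorem memLp_incrDiff (hρ : FiniteSecondMoments ρ) :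
    MemLp (incrDiff i j 0) 2 (Measure.infinitePi fun _ : ℕ => ρ) :=
  (identDistrib_incrDiff ρ i j 0).memLp_iff.mpr ((hρ i).sub (hρ j))

theorem integral_incrDiff (hρ : FiniteSecondMoments ρ) :
    ∫ ξ, incrDiff i j 0 ξ ∂(Measure.infinitePi fun _ : ℕ => ρ) = mean ρ i - mean ρ j := by
  rw [(identDistrib_incrDiff ρ i j 0).integral_eq]
  exact integral_sub ((hρ i).integrable one_le_two) ((hρ j).integrable one_le_two)

theorem ae_bddBelow_sum_incrDiff (hρ : FiniteSecondMoments ρ) (hij : mean ρ j < mean ρ i) :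
    ∀ᵐ ξ ∂(Measure.infinitePi fun _ : ℕ => ρ),
      BddBelow (Set.range fun n => ∑ m ∈ Finset.range n, incrDiff i j m ξ) := by
  filter_upwards [ae_tendsto_sum_atTop ((memLp_incrDiff i j hρ).integrable one_le_two)
    (iIndepFun_incrDiff ρ i j)
    (fun n => (identDistrib_incrDiff ρ i j n).trans (identDistrib_incrDiff ρ i j 0).symm)
    (by rw [integral_incrDiff i j hρ]; exact sub_pos.mpr hij)] with ξ hξ
  exact bddBelow_range_of_tendsto_atTop_atTop hξ

theorem ae_exists_walk_apply_lt (hρ : FiniteSecondMoments ρ) (hij : mean ρ i ≤ mean ρ j)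
    (hne : 0 < ρ {x | x i ≠ x j}) (x : Fin d → ℝ) :
    ∀ᵐ ξ ∂(Measure.infinitePi fun _ : ℕ => ρ), ∃ n, walk x n ξ i < walk x n ξ j := by
  have hdeg : ¬ incrDiff i j 0 =ᵐ[Measure.infinitePi fun _ : ℕ => ρ] 0 := by
    intro h
    have h' := (identDistrib_incrDiff ρ i j 0).ae_snd (measurableSet_singleton (0 : ℝ)) h
    refine hne.ne' (measure_mono_null (fun y hy => ?_) h')
    exact sub_ne_zero.mpr hy
  filter_upwards [ae_exists_sum_lt_of_mean_nonpos (measurable_incrDiff i j)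
    (memLp_incrDiff i j hρ) (iIndepFun_incrDiff ρ i j)
    (fun n => (identDistrib_incrDiff ρ i j n).trans (identDistrib_incrDiff ρ i j 0).symm)
    (by rw [integral_incrDiff i j hρ]; exact sub_nonpos.mpr hij) hdeg (x j - x i)] with ξ hξ
  obtain ⟨n, hn⟩ := hξ
  have := walk_apply_sub i j x n ξ
  exact ⟨n, by linarith⟩

/-- If the random walk keeps the ranking `r` forever with positive probability, then its drift is
strictly ordered according to `r`. -/
theorem mean_lt_of_walk_pos {r : Ranking d} (hρ : FiniteSecondMoments ρ) {x : Fin d → ℝ}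
    (hx : Measure.infinitePi (fun _ : ℕ => ρ) {ξ | ∀ m, rk (walk x m ξ) = r} ≠ 0)
    (hne : 0 < ρ {x | x i ≠ x j}) (hpos : r.pos i ≤ r.pos j) : mean ρ j < mean ρ i := by
  by_contra! hle
  refine hx (measure_mono_null (fun ξ hξ => ?_) (ae_exists_walk_apply_lt i j hρ hle hne x))
  rintro ⟨n, hn⟩
  refine hpos.not_gt ?_
  rw [← hξ n]
  exact (rk_lt_iff _ j i).mpr hn

/-- If the drift of the random walk is strictly ordered according to the strict ranking `r`, then
from some starting position it keeps the ranking `r` forever with positive probability. -/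
theorem exists_walk_pos {r : Ranking d} (hr : r.IsStrict) (hρ : FiniteSecondMoments ρ)
    (hmean : ∀ i j, r.pos i < r.pos j → mean ρ j < mean ρ i) :
    ∃ x, Measure.infinitePi (fun _ : ℕ => ρ) {ξ | ∀ m, rk (walk x m ξ) = r} ≠ 0 := by
  set Q := Measure.infinitePi fun _ : ℕ => ρ
  have hall : ∀ᵐ ξ ∂Q, ∃ M : ℕ, ∀ i j, r.pos i < r.pos j →
      ∀ n, -(M : ℝ) ≤ ∑ m ∈ Finset.range n, incrDiff i j m ξ := by
    have hae : ∀ᵐ ξ ∂Q, ∀ i j, r.pos i < r.pos j →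
        BddBelow (Set.range fun n => ∑ m ∈ Finset.range n, incrDiff i j m ξ) := by
      refine ae_all_iff.mpr fun i => ae_all_iff.mpr fun j => ?_
      by_cases h : r.pos i < r.pos j
      · exact (ae_bddBelow_sum_incrDiff i j hρ (hmean i j h)).mono fun _ hξ _ => hξ
      · exact Eventually.of_forall fun _ h' => absurd h' h
    filter_upwards [hae] with ξ hξ
    have hM : ∀ p : Fin d × Fin d, ∃ M : ℕ, r.pos p.1 < r.pos p.2 →
        ∀ n, -(M : ℝ) ≤ ∑ m ∈ Finset.range n, incrDiff p.1 p.2 m ξ := by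
      intro p
      by_cases h : r.pos p.1 < r.pos p.2
      · obtain ⟨b, hb⟩ := hξ p.1 p.2 h
        obtain ⟨M, hM⟩ := exists_nat_ge (-b)
        exact ⟨M, fun _ n => (neg_le.mp hM).trans (hb (Set.mem_range_self n))⟩
      · exact ⟨0, fun h' => absurd h' h⟩
    choose M hM using hM
    refine ⟨Finset.univ.sup M, fun i j hij n => le_trans ?_ (hM (i, j) hij n)⟩
    exact neg_le_neg (Nat.cast_le.mpr (Finset.le_sup (Finset.mem_univ _)))
  -- Countably many such events cover almost every path, so one of them is not null.
  obtain ⟨M, hM⟩ : ∃ M : ℕ, Q {ξ | ∀ i j, r.pos i < r.pos j →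
      ∀ n, -(M : ℝ) ≤ ∑ m ∈ Finset.range n, incrDiff i j m ξ} ≠ 0 := by
    by_contra! h
    have hnull := measure_iUnion_null h
    have : ∀ᵐ _ξ ∂Q, False := by
      filter_upwards [hall, measure_eq_zero_iff_ae_notMem.mp hnull] with ξ h1 h2
      exact h2 (Set.mem_iUnion.mpr h1)
    exact this.exists.elim fun _ h => h
  -- Initial gaps of at least `M + 1` survive a loss of at most `M`.
  refine ⟨fun i => -((M + 1) * ((r.pos i : ℕ) : ℝ)), fun h => hM (measure_mono_null ?_ h)⟩
  intro ξ hξ n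
  have hlt : ∀ i j, r.pos i < r.pos j →
      walk (fun i => -((M + 1) * ((r.pos i : ℕ) : ℝ))) n ξ j <
        walk (fun i => -((M + 1) * ((r.pos i : ℕ) : ℝ))) n ξ i := by
    intro i j hij
    have h1 := hξ i j hij n
    have h2 := walk_apply_sub i j (fun i => -((M + 1) * ((r.pos i : ℕ) : ℝ))) n ξ
    have h3 : ((r.pos i : ℕ) : ℝ) + 1 ≤ ((r.pos j : ℕ) : ℝ) := by exact_mod_cast hij
    have h4 := mul_le_mul_of_nonneg_left h3 (by positivity : (0 : ℝ) ≤ M + 1)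
    linarith
  refine (rk_unique _ r fun i j => ⟨hlt i j, fun h => ?_⟩).symm
  rcases lt_trichotomy (r.pos i) (r.pos j) with h' | h' | h'
  · exact h'
  -- Strictness enters here: equal positions force `i = j`.
  · exact absurd (hr.injective h' ▸ h) (lt_irrefl _)
  · exact absurd (hlt j i h') h.not_gt

end Increments

/-- A ranking is terminal if and only if it is strict and the means of the components of the
corresponding increments are strictly decreasing along the ranking. -/
theorem isTerminal_iff {d : ℕ} (μ : Ranking d → Measure (Fin d → ℝ))
    [∀ r, IsProbabilityMeasure (μ r)] (hμ : ∀ r, FiniteSecondMoments (μ r))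
    (hne : ∀ (r : Ranking d) (i j : Fin d), i ≠ j → 0 < μ r {x | x i ≠ x j}) (r : Ranking d) :
    IsTerminal μ r ↔ r.IsStrict ∧ ∀ i j, r.pos i < r.pos j → mean (μ r) j < mean (μ r) i := by
  constructor
  · rintro ⟨ν, hν, -, hpos⟩
    -- Convergence to `r` is a countable union over the time from which `r` is kept.
    obtain ⟨k, hk⟩ : ∃ k, processLaw ν μ {ω | ∀ m, rk (ω (k + m)) = r} ≠ 0 := by
      by_contra! h
      refine hpos.ne' (measure_mono_null ?_ (measure_iUnion_null h))
      rintro ω ⟨k, hk⟩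
      exact Set.mem_iUnion.mpr ⟨k, fun m => hk _ (Nat.le_add_right k m)⟩
    rw [processLaw_forall_rk_eq] at hk
    obtain ⟨x, hx⟩ : ∃ x, Measure.infinitePi (fun _ : ℕ => μ r)
        {ξ | ∀ m, rk (walk x m ξ) = r} ≠ 0 := by
      by_contra! h
      simp [h] at hk
    -- The weak inequality of positions matters: a tie could be used in both directions, which is
    -- contradictory.
    have key : ∀ i j, i ≠ j → r.pos i ≤ r.pos j → mean (μ r) j < mean (μ r) i :=
      fun i j hij => mean_lt_of_walk_pos i j (hμ r) hx (hne r i j hij)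
    refine ⟨Finite.injective_iff_bijective.mp fun i j hij => ?_,
      fun i j hij => key i j (fun h => hij.ne (congrArg r.pos h)) hij.le⟩
    by_contra h
    exact lt_asymm (key i j h hij.le) (key j i (Ne.symm h) hij.ge)
  · rintro ⟨hr, hmean⟩
    obtain ⟨x, hx⟩ := exists_walk_pos hr (hμ r) hmean
    refine ⟨Measure.dirac x, inferInstance, fun i => ?_, ?_⟩
    · exact (memLp_const (x i)).ae_eq (ae_eq_dirac fun y : Fin d → ℝ => y i).symm
    · have h0 : ∀ᵐ ω ∂(processLaw (Measure.dirac x) μ), ω 0 = x := by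
        refine ae_of_ae_map (f := fun ω : ℕ → Fin d → ℝ => ω 0) (p := fun y => y = x)
          (measurable_pi_apply 0).aemeasurable ?_
        rw [processLaw_map_eval_zero]
        simp
      have h1 := processLaw_forall_rk_eq (Measure.dirac x) μ r 0
      have h2 : ∫⁻ ω, Measure.infinitePi (fun _ : ℕ => μ r) {ξ | ∀ m, rk (walk (ω 0) m ξ) = r}
          ∂(processLaw (Measure.dirac x) μ) =
          Measure.infinitePi (fun _ : ℕ => μ r) {ξ | ∀ m, rk (walk x m ξ) = r} := by
        rw [lintegral_congr_ae (h0.mono fun ω hω => by rw [hω]), lintegral_const, measure_univ,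
          mul_one]
      refine (pos_of_ne_zero hx).trans_le (h2.symm.trans h1.symm |>.trans_le (measure_mono ?_))
      exact fun ω hω => ⟨0, fun n _ => by simpa using hω n⟩

end RankingBased

theorem mainTheorem6 (d : ℕ) (μ : RankingBased.Ranking d → Measure (Fin d → ℝ))
    [∀ r, IsProbabilityMeasure (μ r)]
    (hμ : ∀ r, RankingBased.FiniteSecondMoments (μ r))
    (hne : ∀ (r : RankingBased.Ranking d) (i j : Fin d), i ≠ j → 0 < μ r {x | x i ≠ x j})
    (r : RankingBased.Ranking d) :
    RankingBased.IsTerminal μ r ↔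
      ∃ h : r.IsStrict, ∀ k l : Fin d, k < l →
        RankingBased.mean (μ r) (h.inv k) > RankingBased.mean (μ r) (h.inv l) := by
  rw [RankingBased.isTerminal_iff μ hμ hne r, ← exists_prop]
  refine exists_congr fun h => ?_
  have hpi : ∀ k, r.pos (h.inv k) = k := (Equiv.ofBijective r.pos h).apply_symm_apply
  have hip : ∀ i, h.inv (r.pos i) = i := (Equiv.ofBijective r.pos h).symm_apply_apply
  constructor
  · intro H k l hkl
    exact H _ _ (by rwa [hpi, hpi])
  · intro H i j hij
    simpa only [hip] using H _ _ hij
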